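/- Let $\lambda_A,\lambda_B\in[0,1]$. Consider an urn containing amounts $n_A$ of red (colour $A$) and $n_B$ of black (colour $B$) balls, and write $p(n_A,n_B)=n_A/(n_A+n_B)$ for the probability of sampling a red ball. At each step a ball is sampled (red with probability $p$ of the current contents, black otherwise) and put back, and then the urn is updated by one of the following rules. (I) Bernoulli urn: if the sampled ball has colour $i\in\{A,B\}$, one more ball of colour $i$ is added with probability $\lambda_i$, and nothing is added with probability $1-\lambda_i$, independently of the past. (II) Deterministic urn with addition matrix $\mathrm{diag}(\lambda_A,\lambda_B)$: if the sampled ball has colour $i$, the amount $\lambda_i$ of colour $i$ is added. Then the following hold. (a) Conditioned on a ball being added, a step of (I) is a step of (II) after rescaling: for all contents $(n_A,n_B)\in[0,\infty)^2$ with $\lambda_A n_A+\lambda_B n_B>0$, if $(n_A',n_B')$ denotes the contents after one step of (I) from $(n_A,n_B)$, then the conditional law of $(\lambda_A n_A',\lambda_B n_B')$ given that $(n_A',n_B')\neq(n_A,n_B)$ is the law of the contents after one step of (II) from $(\lambda_A n_A,\lambda_B n_B)$. (b) Let either urn, (I) or (II), start from a positive (not necessarily integer) amount of each colour, and let $p_n$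 be the probability of sampling a red ball given the contents after $n$ steps, i.e. the fraction of red balls at that time. If $\lambda_A>\lambda_B$, then $p_n\to1$ almost surely; if $\lambda_B>\lambda_A$, then $p_n\to0$ almost surely. -/

import Mathlib

open MeasureTheory ProbabilityTheory Filter Topology unitInterval
open scoped NNReal ENNReal

/-- Contents of a two-colour urn: the amount of red (colour `A`) and of black (colour `B`) balls. -/
abbrev UrnContents : Type := ℝ≥0 × ℝ≥0

/-- The fraction of red balls, i.e. the probability that a ball sampled uniformly from the urn
is red. -/
noncomputable def redFraction (x : UrnContents) : ℝ≥0 := x.1 / (x.1 + x.2)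

theorem redFraction_le_one (x : UrnContents) : redFraction x ≤ 1 :=
  div_le_one_of_le₀ le_self_add zero_le

theorem measurable_redFraction : Measurable redFraction := by
  unfold redFraction; fun_prop

/-- One step of the generalized Pólya urn whose `2 × 2` addition matrix has (possibly random,
independently resampled at each step) rows with laws `rowRed` and `rowBlack`: when the urn contains
`x`, a ball is sampled (red with probability `redFraction x`, black otherwise) and put back, and
then the amounts `r = (r.1, r.2)` of red and black balls are added, where `r` has law `rowRed` if
the sampled ball is red and `rowBlack` if it is black. -/
noncomputable def urnKernel (rowRed rowBlack : Measure UrnContents)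
    [IsProbabilityMeasure rowRed] [IsProbabilityMeasure rowBlack] :
    Kernel UrnContents UrnContents where
  toFun x := redFraction x • rowRed.map (fun r => x + r)
    + (1 - redFraction x) • rowBlack.map (fun r => x + r)
  measurable' := by
    refine Measure.measurable_of_measurable_coe _ fun s hs => ?_
    have key : ∀ ν : Measure UrnContents, [IsProbabilityMeasure ν] →
        Measurable fun x : UrnContents => ν.map (fun r => x + r) s := by
      intro ν _
      have h : ∀ x : UrnContents, ν.map (fun r => x + r) s
          = ν (Prod.mk x ⁻¹' ((fun p : UrnContents × UrnContents => p.1 + p.2) ⁻¹' s)) := by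
        intro x
        rw [Measure.map_apply (by fun_prop) hs]
        rfl
      simp_rw [h]
      exact measurable_measure_prodMk_left (measurable_add hs)
    have hr := measurable_redFraction
    have h1 := key rowRed
    have h2 := key rowBlack
    simp only [Measure.add_apply, Measure.smul_apply, ENNReal.smul_def, smul_eq_mul]
    fun_prop

instance (rowRed rowBlack : Measure UrnContents)
    [IsProbabilityMeasure rowRed] [IsProbabilityMeasure rowBlack] :
    IsMarkovKernel (urnKernel rowRed rowBlack) where
  isProbabilityMeasure x := by
    refine ⟨?_⟩
    change (redFraction x • rowRed.map (fun r => x + r)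
      + (1 - redFraction x) • rowBlack.map (fun r => x + r)) Set.univ = 1
    rw [Measure.add_apply, Measure.smul_apply, Measure.smul_apply,
      Measure.map_apply (by fun_prop) .univ, Measure.map_apply (by fun_prop) .univ]
    simp only [Set.preimage_univ, measure_univ, ENNReal.smul_def, smul_eq_mul, mul_one]
    rw [← ENNReal.coe_add, add_tsub_cancel_of_le (redFraction_le_one x), ENNReal.coe_one]

/-- The law of the Markov chain started at `x₀` with transition kernel `κ`, as a measure on the
space of trajectories. -/
noncomputable def chainLaw (κ : Kernel UrnContents UrnContents) [IsMarkovKernel κ]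
    (x₀ : UrnContents) : Measure (ℕ → UrnContents) :=
  Kernel.trajMeasure (X := fun _ => UrnContents) (Measure.dirac x₀)
    (fun n => κ.comap (fun h : (Finset.Iic n → UrnContents) => h ⟨n, Finset.mem_Iic.2 le_rfl⟩)
      (by fun_prop))

/-- One step of the urn with addition matrix `diag(X_A, X_B)`, where `X_A`, `X_B` are Bernoulli
variables with parameters `lamA`, `lamB`. -/
noncomputable abbrev bernoulliUrn (lamA lamB : I) : Kernel UrnContents UrnContents :=
  urnKernel (bernoulliMeasure (1, 0) (0, 0) lamA) (bernoulliMeasure (0, 1) (0, 0) lamB)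

/-- One step of the urn with deterministic addition matrix `diag(lamA, lamB)`. -/
noncomputable abbrev diagUrn (lamA lamB : I) : Kernel UrnContents UrnContents :=
  urnKernel (Measure.dirac (toNNReal lamA, 0)) (Measure.dirac (0, toNNReal lamB))

/-- Contents after multiplying the red amount by `lamA` and the black amount by `lamB`. -/
noncomputable def rescale (lamA lamB : I) (x : UrnContents) : UrnContents :=
  (toNNReal lamA * x.1, toNNReal lamB * x.2)

/-! (a) Given that a ball is added, it is red with probability proportional to `lamA * x.1` and
black with probability proportional to `lamB * x.2`: the sampling probabilities of the rescaled urn.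

(b) Both urns have the same mean additions and increments in `[0, 1]`, and only this is used
(`IsUrnProcess`, `isUrnProcess_chainLaw`). Let `R` have the larger rate `a > b`. The drift of `R` is
at least a multiple of `1 / (n + 1)`, so `R` diverges (`tendsto_left_atTop`). For `θ < 1` with `b <
θ * a`, the process `B * R ^ (-θ)` is a nonnegative supermartingale once `R` is large
(`condExp_mul_rpow_le`), hence converges; dividing by `R ^ (1 - θ) → ∞` gives `B / R → 0`
(`ae_tendsto_div_zero`). -/

/-- A pair of processes `R`, `B` evolving as the two colours of an urn with reinforcement rates
`a` and `b`: the increments lie in `[0, 1]`, and their conditional expectations given the past are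
`a` and `b` times the current fraction of the respective colour. -/
structure IsUrnProcess {Ω : Type*} {m0 : MeasurableSpace Ω} (μ : Measure Ω)
    (ℱ : Filtration ℕ m0) (R B : ℕ → Ω → ℝ) (a b r₀ b₀ : ℝ) : Prop where
  adapted_left : StronglyAdapted ℱ R
  adapted_right : StronglyAdapted ℱ B
  zero_left : ∀ᵐ ω ∂μ, R 0 ω = r₀
  zero_right : ∀ᵐ ω ∂μ, B 0 ω = b₀
  increment_left : ∀ᵐ ω ∂μ, ∀ n, R (n + 1) ω - R n ω ∈ Set.Icc 0 1
  increment_right : ∀ᵐ ω ∂μ, ∀ n, B (n + 1) ω - B n ω ∈ Set.Icc 0 1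
  condExp_left : ∀ n, μ[R (n + 1) - R n | ℱ n] =ᵐ[μ] fun ω => a * (R n ω / (R n ω + B n ω))
  condExp_right : ∀ n, μ[B (n + 1) - B n | ℱ n] =ᵐ[μ] fun ω => b * (B n ω / (R n ω + B n ω))

/-! ### Growth of a single colour. -/

namespace IsUrnProcess

variable {Ω : Type*} {m0 : MeasurableSpace Ω} {μ : Measure Ω} {ℱ : Filtration ℕ m0}
  {R B : ℕ → Ω → ℝ} {a b r₀ b₀ : ℝ}

theorem symm (h : IsUrnProcess μ ℱ R B a b r₀ b₀) : IsUrnProcess μ ℱ B R b a b₀ r₀ where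
  adapted_left := h.adapted_right
  adapted_right := h.adapted_left
  zero_left := h.zero_right
  zero_right := h.zero_left
  increment_left := h.increment_right
  increment_right := h.increment_left
  condExp_left n := by simpa only [add_comm (B n _)] using h.condExp_right n
  condExp_right n := by simpa only [add_comm (B n _)] using h.condExp_left n

theorem ae_bounds (h : IsUrnProcess μ ℱ R B a b r₀ b₀) :
    ∀ᵐ ω ∂μ, ∀ n, r₀ ≤ R n ω ∧ R n ω ≤ r₀ + n := by
  filter_upwards [h.zero_left, h.increment_left] with ω h0 hi n
  induction n with
  | zero => simp [h0]
  | succ n ih =>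
    have := hi n
    rw [Set.mem_Icc] at this
    push_cast
    constructor <;> linarith [ih.1, ih.2]

theorem integrable_left [IsFiniteMeasure μ] (h : IsUrnProcess μ ℱ R B a b r₀ b₀) (n : ℕ) :
    Integrable (R n) μ := by
  refine Integrable.of_bound ((h.adapted_left n).mono (ℱ.le n)).aestronglyMeasurable
    (|r₀| + n) ?_
  filter_upwards [h.ae_bounds] with ω hω
  rw [Real.norm_eq_abs, abs_le]
  constructor <;> linarith [hω n, neg_abs_le r₀, le_abs_self r₀, (Nat.cast_nonneg n : (0 : ℝ) ≤ n)]

/-- Conditional Borel–Cantelli: a monotone process with bounded increments diverges exactly where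
its predictable part does, and here the latter dominates a harmonic series. -/
theorem tendsto_left_atTop [IsFiniteMeasure μ] (h : IsUrnProcess μ ℱ R B a b r₀ b₀)
    (ha : 0 < a) (hr : 0 < r₀) (hb : 0 ≤ b₀) :
    ∀ᵐ ω ∂μ, Tendsto (fun n => R n ω) atTop atTop := by
  have key := tendsto_sum_indicator_atTop_iff (R := 1) (μ := μ) (ℱ := ℱ) (f := R)
    (by filter_upwards [h.increment_left] with ω hω n using sub_nonneg.1 (hω n).1)
    h.adapted_left h.integrable_left
    (by
      filter_upwards [h.increment_left] with ω hω n
      rw [abs_of_nonneg (hω n).1]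
      simpa using (hω n).2)
  filter_upwards [key, h.ae_bounds, h.symm.ae_bounds, ae_all_iff.2 h.condExp_left]
    with ω hω hR hB hc
  refine hω.2 ?_
  have hC : 0 < a * r₀ / (r₀ + b₀ + 1) := by positivity
  refine tendsto_atTop_mono (fun n => ?_)
    (Real.tendsto_sum_range_one_div_nat_succ_atTop.const_mul_atTop hC)
  rw [predictablePart, Finset.sum_apply, Finset.mul_sum]
  refine Finset.sum_le_sum fun i _ => ?_
  rw [hc i]
  have hi : (0 : ℝ) ≤ i := Nat.cast_nonneg i
  have hRi := hR i
  have hBi := hB i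
  have hRp : 0 < R i ω := hr.trans_le hRi.1
  have hBp : 0 ≤ B i ω := hb.trans hBi.1
  -- The fraction is smallest when `R i` stays at `r₀` and `B i` reaches `b₀ + i`; moreover `r₀ + b₀
  -- + i ≤ (r₀ + b₀ + 1) * (i + 1)`.
  have h1 : r₀ / (r₀ + b₀ + 1) * (1 / ((i : ℝ) + 1)) ≤ R i ω / (R i ω + B i ω) := by
    rw [div_mul_div_comm, mul_one, div_le_div_iff₀ (by positivity) (by positivity)]
    have e1 : r₀ * B i ω ≤ R i ω * (b₀ + i) := by gcongr <;> linarith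
    nlinarith [mul_nonneg hRp.le (mul_nonneg hi (add_nonneg hr.le hb)), mul_nonneg hRp.le hi]
  calc a * r₀ / (r₀ + b₀ + 1) * (1 / ((i : ℝ) + 1))
      = a * (r₀ / (r₀ + b₀ + 1) * (1 / ((i : ℝ) + 1))) := by ring
    _ ≤ _ := by gcongr

end IsUrnProcess

/-- Bernoulli's inequality for an exponent in `[0, 1]`. Replacing `x + d` by `x + 1` in the
denominator makes the bound affine in `d`, so that only the conditional mean of the increment
matters. -/
theorem rpow_neg_le_of_increment {x d θ : ℝ} (hx : 0 < x) (hd : 0 ≤ d) (hd1 : d ≤ 1)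
    (h0 : 0 ≤ θ) (h1 : θ ≤ 1) :
    (x + d) ^ (-θ) ≤ x ^ (-θ) * (1 - θ / (x + 1) * d) := by
  have hxd : 0 < x + d := by linarith
  have e : (x + d) ^ (-θ) = x ^ (-θ) * (1 + -(d / (x + d))) ^ θ := by
    have : 1 + -(d / (x + d)) = x / (x + d) := by field_simp; ring
    rw [this, Real.div_rpow hx.le hxd.le, Real.rpow_neg hx.le, Real.rpow_neg hxd.le]
    have := (Real.rpow_pos_of_pos hx θ).ne'
    field_simp
  rw [e]
  have hle : d / (x + d) ≤ 1 := by rw [div_le_one hxd]; linarith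
  have hb := rpow_one_add_le_one_add_mul_self (s := -(d / (x + d))) (by linarith) h0 h1
  have h2 : θ / (x + 1) * d ≤ θ * (d / (x + d)) := by
    rw [div_mul_eq_mul_div, mul_div_assoc]
    gcongr
  gcongr
  linarith

/-- A nonnegative supermartingale converges almost surely. -/
theorem MeasureTheory.Supermartingale.exists_ae_tendsto_of_nonneg {Ω : Type*}
    {m0 : MeasurableSpace Ω} {μ : Measure Ω} [IsFiniteMeasure μ] {ℱ : Filtration ℕ m0}
    {f : ℕ → Ω → ℝ} (hf : Supermartingale f ℱ μ) (h0 : ∀ n, 0 ≤ᵐ[μ] f n) :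
    ∀ᵐ ω ∂μ, ∃ c, Tendsto (fun n => f n ω) atTop (𝓝 c) := by
  -- By nonnegativity the `L¹` norms are the means, which never exceed the initial one.
  have := hf.neg.exists_ae_tendsto_of_bdd (R := (∫ ω, f 0 ω ∂μ).toNNReal) fun n => by
    rw [Pi.neg_apply, eLpNorm_neg, eLpNorm_one_eq_lintegral_enorm]
    calc ∫⁻ ω, ‖f n ω‖ₑ ∂μ = ∫⁻ ω, ENNReal.ofReal (f n ω) ∂μ := by
          refine lintegral_congr_ae ?_
          filter_upwards [h0 n] with ω hω using Real.enorm_of_nonneg hω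
      _ = ENNReal.ofReal (∫ ω, f n ω ∂μ) :=
          (ofReal_integral_eq_lintegral_ofReal (hf.integrable n) (h0 n)).symm
      _ ≤ ENNReal.ofReal (∫ ω, f 0 ω ∂μ) := by
          refine ENNReal.ofReal_le_ofReal ?_
          simpa using hf.setIntegral_le (Nat.zero_le n) MeasurableSet.univ
  filter_upwards [this] with ω ⟨c, hc⟩
  exact ⟨-c, by simpa using hc.neg⟩

/-! ### The supermartingale `B * R ^ (-θ)` and the dominance of the faster colour. -/

namespace IsUrnProcess

variable {Ω : Type*} {m0 : MeasurableSpace Ω} {μ : Measure Ω} {ℱ : Filtration ℕ m0}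
  {R B : ℕ → Ω → ℝ} {a b r₀ b₀ θ c : ℝ}

theorem stronglyMeasurable_rpow (h : IsUrnProcess μ ℱ R B a b r₀ b₀) (θ : ℝ) (n : ℕ) :
    StronglyMeasurable[ℱ n] fun ω => R n ω ^ (-θ) :=
  ((h.adapted_left n).measurable.pow_const (-θ)).stronglyMeasurable

theorem stronglyMeasurable_mul_rpow (h : IsUrnProcess μ ℱ R B a b r₀ b₀) (θ : ℝ) (n : ℕ) :
    StronglyMeasurable[ℱ n] fun ω => B n ω * R n ω ^ (-θ) :=
  (h.adapted_right n).mul (h.stronglyMeasurable_rpow θ n)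

theorem ae_rpow_le (h : IsUrnProcess μ ℱ R B a b r₀ b₀) (hr : 0 < r₀) (h0 : 0 ≤ θ) :
    ∀ᵐ ω ∂μ, ∀ n, R n ω ^ (-θ) ≤ r₀ ^ (-θ) := by
  filter_upwards [h.ae_bounds] with ω hω n
  exact Real.rpow_le_rpow_of_nonpos hr (hω n).1 (by linarith)

theorem ae_mul_rpow_bounds (h : IsUrnProcess μ ℱ R B a b r₀ b₀) (hr : 0 < r₀) (hb : 0 ≤ b₀)
    (h0 : 0 ≤ θ) :
    ∀ᵐ ω ∂μ, ∀ n, 0 ≤ B n ω * R n ω ^ (-θ) ∧ B n ω * R n ω ^ (-θ) ≤ (b₀ + n) * r₀ ^ (-θ) := by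
  filter_upwards [h.ae_bounds, h.symm.ae_bounds, h.ae_rpow_le hr h0] with ω hR hB hω n
  have h1 := Real.rpow_nonneg (hr.le.trans (hR n).1) (-θ)
  have h2 := hb.trans (hB n).1
  exact ⟨mul_nonneg h2 h1, mul_le_mul (hB n).2 (hω n) h1 (by positivity)⟩

theorem integrable_mul_rpow [IsFiniteMeasure μ] (h : IsUrnProcess μ ℱ R B a b r₀ b₀)
    (hr : 0 < r₀) (hb : 0 ≤ b₀) (h0 : 0 ≤ θ) (n : ℕ) :
    Integrable (fun ω => B n ω * R n ω ^ (-θ)) μ := by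
  refine Integrable.of_bound ((h.stronglyMeasurable_mul_rpow θ n).mono
    (ℱ.le n)).aestronglyMeasurable ((b₀ + n) * r₀ ^ (-θ)) ?_
  filter_upwards [h.ae_mul_rpow_bounds hr hb h0] with ω hω
  rw [Real.norm_of_nonneg (hω n).1]
  exact (hω n).2

/-- As soon as `R n` exceeds a suitable threshold, `B / R ^ θ` decreases in conditional mean. -/
theorem condExp_mul_rpow_le [IsFiniteMeasure μ] (h : IsUrnProcess μ ℱ R B a b r₀ b₀)
    (hr : 0 < r₀) (hb : 0 ≤ b₀) (h0 : 0 ≤ θ) (h1 : θ ≤ 1)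
    (hc : ∀ r, c ≤ r → b * (r + 1) ≤ θ * a * r) (n : ℕ) :
    ∀ᵐ ω ∂μ, c ≤ R n ω →
      (μ[fun ω => B (n + 1) ω * R (n + 1) ω ^ (-θ) | ℱ n]) ω ≤ B n ω * R n ω ^ (-θ) := by
  set f : ℕ → Ω → ℝ := fun n ω => B n ω * R n ω ^ (-θ) with hf
  set u : Ω → ℝ := fun ω => R n ω ^ (-θ) with hu
  set v : Ω → ℝ := fun ω => f n ω * (θ / (R n ω + 1)) with hv
  have hfi : ∀ n, Integrable (f n) μ := h.integrable_mul_rpow hr hb h0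
  have hfm : StronglyMeasurable[ℱ n] (f n) := h.stronglyMeasurable_mul_rpow θ n
  have hum : StronglyMeasurable[ℱ n] u := h.stronglyMeasurable_rpow θ n
  have hvm : StronglyMeasurable[ℱ n] v :=
    hfm.mul (((h.adapted_left n).measurable.add_const 1).const_div θ).stronglyMeasurable
  have hub : ∀ᵐ ω ∂μ, ‖u ω‖ ≤ r₀ ^ (-θ) := by
    filter_upwards [h.ae_bounds, h.ae_rpow_le hr h0] with ω hR hω
    rw [Real.norm_of_nonneg (Real.rpow_nonneg (hr.le.trans (hR n).1) _)]
    exact hω n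
  have hvb : ∀ᵐ ω ∂μ, ‖v ω‖ ≤ (b₀ + n) * r₀ ^ (-θ) := by
    filter_upwards [h.ae_bounds, h.ae_mul_rpow_bounds hr hb h0] with ω hR hω
    have hRn := hr.trans_le (hR n).1
    have h2 : θ / (R n ω + 1) ≤ 1 := by rw [div_le_one (by positivity)]; linarith
    rw [Real.norm_of_nonneg (mul_nonneg (hω n).1 (by positivity))]
    exact (mul_le_of_le_one_right (hω n).1 h2).trans (hω n).2
  have hdR : Integrable (R (n + 1) - R n) μ := (h.integrable_left _).sub (h.integrable_left _)
  have hdB : Integrable (B (n + 1) - B n) μ :=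
    (h.symm.integrable_left _).sub (h.symm.integrable_left _)
  have hui : Integrable (u * (B (n + 1) - B n)) μ :=
    hdB.bdd_mul (hum.mono (ℱ.le n)).aestronglyMeasurable hub
  have hvi : Integrable (v * (R (n + 1) - R n)) μ :=
    hdR.bdd_mul (hvm.mono (ℱ.le n)).aestronglyMeasurable hvb
  -- The bound is affine in the two increments, with coefficients `u`, `v` known at time `n`, which
  -- come out of the conditional expectation.
  have hle : f (n + 1) ≤ᵐ[μ] f n + u * (B (n + 1) - B n) - v * (R (n + 1) - R n) := by
    filter_upwards [h.ae_bounds, h.symm.ae_bounds, h.increment_left, h.increment_right]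
      with ω hR hB hdR hdB
    have hRn := hr.trans_le (hR n).1
    have hRn' := hr.trans_le (hR (n + 1)).1
    have hBn := hb.trans (hB n).1
    have e1 := rpow_neg_le_of_increment hRn (hdR n).1 (hdR n).2 h0 h1
    rw [add_sub_cancel] at e1
    have e2 : R (n + 1) ω ^ (-θ) ≤ R n ω ^ (-θ) :=
      Real.rpow_le_rpow_of_nonpos hRn (sub_nonneg.1 (hdR n).1) (by linarith)
    simp only [hf, hu, hv, Pi.add_apply, Pi.sub_apply, Pi.mul_apply]
    calc B (n + 1) ω * R (n + 1) ω ^ (-θ)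
        = B n ω * R (n + 1) ω ^ (-θ) + R (n + 1) ω ^ (-θ) * (B (n + 1) ω - B n ω) := by ring
      _ ≤ B n ω * (R n ω ^ (-θ) * (1 - θ / (R n ω + 1) * (R (n + 1) ω - R n ω)))
          + R n ω ^ (-θ) * (B (n + 1) ω - B n ω) :=
        add_le_add (mul_le_mul_of_nonneg_left e1 hBn) (mul_le_mul_of_nonneg_right e2 (hdB n).1)
      _ = _ := by ring
  filter_upwards [condExp_mono (hfi (n + 1)) (((hfi n).add hui).sub hvi) hle,
    condExp_sub ((hfi n).add hui) hvi (ℱ n), condExp_add (hfi n) hui (ℱ n),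
    condExp_stronglyMeasurable_mul_of_bound (ℱ.le n) hum hdB _ hub,
    condExp_stronglyMeasurable_mul_of_bound (ℱ.le n) hvm hdR _ hvb,
    h.condExp_left n, h.condExp_right n, h.ae_bounds, h.symm.ae_bounds]
    with ω i1 i2 i3 i4 i5 i6 i7 hR hB hcR
  refine i1.trans ?_
  rw [i2, Pi.sub_apply, i3, Pi.add_apply, i4, Pi.mul_apply, i5, Pi.mul_apply, i6, i7,
    condExp_of_stronglyMeasurable (ℱ.le n) hfm (hfi n)]
  have hRn := hr.trans_le (hR n).1
  have hBn := hb.trans (hB n).1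
  have hu0 : 0 ≤ R n ω ^ (-θ) := Real.rpow_nonneg hRn.le _
  have e : u ω * (b * (B n ω / (R n ω + B n ω))) - v ω * (a * (R n ω / (R n ω + B n ω)))
      = R n ω ^ (-θ) * B n ω / ((R n ω + B n ω) * (R n ω + 1))
        * (b * (R n ω + 1) - θ * a * R n ω) := by
    simp only [hf, hu, hv]
    field_simp
  have e' := mul_nonpos_of_nonneg_of_nonpos
    (by positivity : 0 ≤ R n ω ^ (-θ) * B n ω / ((R n ω + B n ω) * (R n ω + 1)))
    (sub_nonpos.2 (hc _ hcR))
  linarith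

/-- The threshold may be passed only at a later time `k`. The event `c ≤ R k` is known from time `k`
on and persists since `R` is monotone, so restricting to it and shifting time by `k` gives a true
supermartingale. -/
theorem ae_exists_tendsto_mul_rpow [IsFiniteMeasure μ] (h : IsUrnProcess μ ℱ R B a b r₀ b₀)
    (hr : 0 < r₀) (hb : 0 ≤ b₀) (h0 : 0 ≤ θ) (h1 : θ ≤ 1)
    (hc : ∀ r, c ≤ r → b * (r + 1) ≤ θ * a * r) :
    ∀ᵐ ω ∂μ, ∀ k, c ≤ R k ω → ∃ l, Tendsto (fun n => B n ω * R n ω ^ (-θ)) atTop (𝓝 l) := by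
  refine ae_all_iff.2 fun k => ?_
  let 𝒢 : Filtration ℕ m0 :=
    ⟨fun n => ℱ (n + k), fun _ _ hij => ℱ.mono (by gcongr), fun n => ℱ.le _⟩
  let S : Set Ω := {ω | c ≤ R k ω}
  have hS : ∀ n, MeasurableSet[ℱ (n + k)] S := fun n =>
    ℱ.mono (Nat.le_add_left k n) _ (measurableSet_le measurable_const (h.adapted_left k).measurable)
  let f : ℕ → Ω → ℝ := fun n ω => B n ω * R n ω ^ (-θ)
  have hfi : ∀ n, Integrable (f n) μ := h.integrable_mul_rpow hr hb h0
  have hsup : Supermartingale (fun n => S.indicator (f (n + k))) 𝒢 μ := by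
    refine supermartingale_nat
      (fun n => (h.stronglyMeasurable_mul_rpow θ (n + k)).indicator (hS n))
      (fun n => (hfi _).indicator (ℱ.le _ _ (hS n))) fun n => ?_
    filter_upwards [condExp_indicator (hfi (n + 1 + k)) (hS n),
      h.condExp_mul_rpow_le hr hb h0 h1 hc (n + k), h.increment_left] with ω i1 i2 i3
    change (μ[S.indicator (f (n + 1 + k)) | ℱ (n + k)]) ω ≤ _
    rw [i1]
    by_cases hω : ω ∈ S
    · rw [Set.indicator_of_mem hω, Set.indicator_of_mem hω, add_right_comm]
      have hmono : Monotone fun n => R n ω := monotone_nat_of_le_succ fun n => sub_nonneg.1 (i3 n).1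
      exact i2 (le_trans hω (hmono (Nat.le_add_left k n)))
    · rw [Set.indicator_of_notMem hω, Set.indicator_of_notMem hω]
  have hnn : ∀ n, 0 ≤ᵐ[μ] S.indicator (f (n + k)) := fun n => by
    filter_upwards [h.ae_mul_rpow_bounds hr hb h0] with ω hω
    exact Set.indicator_apply_nonneg fun _ => (hω (n + k)).1
  filter_upwards [hsup.exists_ae_tendsto_of_nonneg hnn] with ω ⟨l, hl⟩ hω
  refine ⟨l, (tendsto_add_atTop_iff_nat k).1 ?_⟩
  simpa only [Set.indicator_of_mem (show ω ∈ S from hω)] using hl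

/-- The colour with the larger reinforcement rate takes over the urn. -/
theorem ae_tendsto_div_zero [IsFiniteMeasure μ] (h : IsUrnProcess μ ℱ R B a b r₀ b₀)
    (hr : 0 < r₀) (hb : 0 ≤ b₀) (h0 : 0 ≤ b) (hab : b < a) :
    ∀ᵐ ω ∂μ, Tendsto (fun n => B n ω / R n ω) atTop (𝓝 0) := by
  have ha : 0 < a := h0.trans_lt hab
  -- Chosen so that `θ * a` is the midpoint of `b` and `a`; the threshold `2 * b / (a - b)` solves
  -- `b * (r + 1) = θ * a * r`.
  set θ : ℝ := (a + b) / 2 / a with hθ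
  have hθa : θ * a = (a + b) / 2 := div_mul_cancel₀ _ ha.ne'
  have hθ0 : 0 ≤ θ := by positivity
  have hθ1 : θ < 1 := by rw [hθ, div_lt_one ha]; linarith
  have hc : ∀ r, 2 * b / (a - b) ≤ r → b * (r + 1) ≤ θ * a * r := fun r hr => by
    rw [div_le_iff₀ (sub_pos.2 hab)] at hr
    rw [hθa]
    linarith
  filter_upwards [h.ae_exists_tendsto_mul_rpow hr hb hθ0 hθ1.le hc, h.tendsto_left_atTop ha hr hb,
    h.ae_bounds] with ω h1 h2 h3
  obtain ⟨k, hk⟩ := (h2.eventually_ge_atTop (2 * b / (a - b))).exists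
  obtain ⟨l, hl⟩ := h1 k hk
  -- `B / R` is `B * R ^ (-θ)`, which converges, times `R ^ (-(1 - θ))`, which vanishes.
  have h4 := hl.mul ((tendsto_rpow_neg_atTop (sub_pos.2 hθ1)).comp h2)
  rw [mul_zero] at h4
  refine h4.congr fun n => ?_
  have hRn := hr.trans_le (h3 n).1
  rw [Function.comp_apply, mul_assoc, ← Real.rpow_add hRn, div_eq_mul_inv, ← Real.rpow_neg_one]
  congr 2
  ring

end IsUrnProcess

/-! ### Initial law and Markov property of the trajectory measure. -/

section Chain

variable (κ : Kernel UrnContents UrnContents) [IsMarkovKernel κ] (x₀ : UrnContents)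

instance : IsProbabilityMeasure (chainLaw κ x₀) := by unfold chainLaw; infer_instance

theorem ae_chainLaw_zero : ∀ᵐ X ∂chainLaw κ x₀, X 0 = x₀ := by
  have key : (chainLaw κ x₀).map (Preorder.frestrictLe (π := fun _ => UrnContents) 0)
      = (Measure.dirac x₀).map
        (MeasurableEquiv.piUnique (fun _ : Finset.Iic 0 => UrnContents)).symm := by
    rw [chainLaw, Kernel.trajMeasure, Measure.map_comp _ _ (by fun_prop),
      Kernel.traj_map_frestrictLe, Kernel.partialTraj_self]
    exact Measure.id_comp
  have h : ∀ᵐ z ∂(chainLaw κ x₀).map (Preorder.frestrictLe (π := fun _ => UrnContents) 0),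
      z ⟨0, Finset.mem_Iic.2 le_rfl⟩ = x₀ := by
    rw [key]
    refine (ae_map_iff (MeasurableEquiv.measurable _).aemeasurable
      (measurableSet_eq_fun (by fun_prop) measurable_const)).2 ?_
    refine (ae_dirac_iff ?_).2 rfl
    exact measurableSet_eq_fun ((measurable_pi_apply _).comp (MeasurableEquiv.measurable _))
      measurable_const
  exact ae_of_ae_map (by fun_prop) h

theorem ae_chainLaw_step {p : UrnContents → UrnContents → Prop}
    (hp : MeasurableSet {z : UrnContents × UrnContents | p z.1 z.2})
    (h : ∀ x, ∀ᵐ y ∂κ x, p x y) (n : ℕ) : ∀ᵐ X ∂chainLaw κ x₀, p (X n) (X (n + 1)) := by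
  have hm : Measurable fun X : ℕ → UrnContents =>
      (Preorder.frestrictLe (π := fun _ => UrnContents) n X, X (n + 1)) := by fun_prop
  refine ae_of_ae_map (p := fun z : (Finset.Iic n → UrnContents) × UrnContents =>
    p (z.1 ⟨n, Finset.mem_Iic.2 le_rfl⟩) z.2) hm.aemeasurable ?_
  rw [chainLaw, ← Kernel.map_frestrictLe_trajMeasure_compProd_eq_map_trajMeasure]
  refine Measure.ae_compProd_of_ae_ae ?_ (ae_of_all _ fun z => ?_)
  · exact hp.preimage (by fun_prop : Measurable
      fun z : (Finset.Iic n → UrnContents) × UrnContents =>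
        (z.1 ⟨n, Finset.mem_Iic.2 le_rfl⟩, z.2))
  · exact h _

theorem condExp_chainLaw_step {g : UrnContents → UrnContents → ℝ}
    (hg : Measurable fun z : UrnContents × UrnContents => g z.1 z.2) (n : ℕ)
    (hi : Integrable (fun X : ℕ → UrnContents => g (X n) (X (n + 1))) (chainLaw κ x₀)) :
    (chainLaw κ x₀)[fun X => g (X n) (X (n + 1)) |
        Filtration.piLE (X := fun _ => UrnContents) n]
      =ᵐ[chainLaw κ x₀] fun X => ∫ y, g (X n) y ∂κ (X n) := by
  have hm : Measurable fun z : (Finset.Iic n → UrnContents) × UrnContents =>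
      g (z.1 ⟨n, Finset.mem_Iic.2 le_rfl⟩) z.2 :=
    hg.comp (by fun_prop : Measurable fun z : (Finset.Iic n → UrnContents) × UrnContents =>
        (z.1 ⟨n, Finset.mem_Iic.2 le_rfl⟩, z.2))
  have h1 := condExp_prod_ae_eq_integral_condDistrib (μ := chainLaw κ x₀)
    (X := Preorder.frestrictLe (π := fun _ => UrnContents) n) (Y := fun X => X (n + 1))
    (by fun_prop) (measurable_pi_apply (n + 1)).aemeasurable hm.stronglyMeasurable hi
  rw [Filtration.piLE_eq_comap_frestrictLe]
  have h2 := ae_of_ae_map (by fun_prop) (Kernel.condDistrib_trajMeasure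
    (X := fun _ => UrnContents) (μ₀ := Measure.dirac x₀)
    (κ := fun n => κ.comap (fun h : (Finset.Iic n → UrnContents) =>
      h ⟨n, Finset.mem_Iic.2 le_rfl⟩) (by fun_prop)) (a := n))
  filter_upwards [h1, h2] with X e1 e2
  refine e1.trans ?_
  unfold chainLaw
  rw [e2]
  rfl

end Chain

/-! ### From urn kernels to urn processes. -/

section Rows

variable {rowRed rowBlack : Measure UrnContents} [IsProbabilityMeasure rowRed]
  [IsProbabilityMeasure rowBlack]

theorem urnKernel_apply (x : UrnContents) : urnKernel rowRed rowBlack x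
    = redFraction x • rowRed.map (fun r => x + r)
      + (1 - redFraction x) • rowBlack.map (fun r => x + r) := rfl

theorem ae_urnKernel {x : UrnContents} {p : UrnContents → Prop} (hp : MeasurableSet {y | p y})
    (hR : ∀ᵐ r ∂rowRed, p (x + r)) (hB : ∀ᵐ r ∂rowBlack, p (x + r)) :
    ∀ᵐ y ∂urnKernel rowRed rowBlack x, p y := by
  rw [urnKernel_apply, ae_add_measure_iff]
  exact ⟨Measure.ae_smul_measure ((ae_map_iff (by fun_prop) hp).2 hR) _,
    Measure.ae_smul_measure ((ae_map_iff (by fun_prop) hp).2 hB) _⟩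

theorem integral_urnKernel (x : UrnContents) {g : UrnContents → ℝ} (hg : Measurable g)
    (hR : Integrable (fun r => g (x + r)) rowRed) (hB : Integrable (fun r => g (x + r)) rowBlack) :
    ∫ y, g y ∂urnKernel rowRed rowBlack x
      = redFraction x * ∫ r, g (x + r) ∂rowRed
        + (1 - redFraction x) * ∫ r, g (x + r) ∂rowBlack := by
  have hm : Measurable fun r : UrnContents => x + r := by fun_prop
  rw [urnKernel_apply, integral_add_measure
      (((integrable_map_measure hg.aestronglyMeasurable hm.aemeasurable).2 hR).smul_measure_nnreal)
      (((integrable_map_measure hg.aestronglyMeasurable hm.aemeasurable).2 hB).smul_measure_nnreal),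
    integral_smul_nnreal_measure, integral_smul_nnreal_measure,
    integral_map hm.aemeasurable hg.aestronglyMeasurable,
    integral_map hm.aemeasurable hg.aestronglyMeasurable, NNReal.smul_def, NNReal.smul_def,
    NNReal.coe_sub (redFraction_le_one x)]
  rfl

theorem coe_redFraction (x : UrnContents) : (redFraction x : ℝ) = x.1 / (x.1 + x.2) := by
  simp [redFraction]

theorem one_sub_redFraction {x : UrnContents} (hx : x.1 + x.2 ≠ 0) :
    1 - (redFraction x : ℝ) = x.2 / (x.1 + x.2) := by
  have : (x.1 + x.2 : ℝ) ≠ 0 := by exact_mod_cast hx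
  rw [coe_redFraction]
  field_simp
  ring

/-- If drawing red only adds red balls, at most one and `a` on average, and drawing black only adds
black balls, at most one and `b` on average, then the amounts of red and black balls form an urn
process with rates `a` and `b`. -/
theorem isUrnProcess_chainLaw {a b : ℝ} (hRed : ∀ᵐ r ∂rowRed, r.1 ≤ 1 ∧ r.2 = 0)
    (hBlack : ∀ᵐ r ∂rowBlack, r.1 = 0 ∧ r.2 ≤ 1) (ha : ∫ r, (r.1 : ℝ) ∂rowRed = a)
    (hb : ∫ r, (r.2 : ℝ) ∂rowBlack = b) {x₀ : UrnContents} (hx₀ : 0 < x₀.1) :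
    IsUrnProcess (chainLaw (urnKernel rowRed rowBlack) x₀)
      (Filtration.piLE (X := fun _ => UrnContents))
      (fun n X => ((X n).1 : ℝ)) (fun n X => ((X n).2 : ℝ)) a b x₀.1 x₀.2 := by
  have hinc : ∀ x, ∀ᵐ y ∂urnKernel rowRed rowBlack x,
      (y.1 : ℝ) - x.1 ∈ Set.Icc (0 : ℝ) 1 ∧ (y.2 : ℝ) - x.2 ∈ Set.Icc (0 : ℝ) 1 := by
    intro x
    refine ae_urnKernel ?_ ?_ ?_
    · exact (measurableSet_Icc.preimage (by fun_prop)).inter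
        (measurableSet_Icc.preimage (by fun_prop))
    · filter_upwards [hRed] with r hr
      simp [hr.2, hr.1]
    · filter_upwards [hBlack] with r hr
      simp [hr.2, hr.1]
  have hstep : ∀ᵐ X ∂chainLaw (urnKernel rowRed rowBlack) x₀, ∀ n,
      ((X (n + 1)).1 : ℝ) - (X n).1 ∈ Set.Icc (0 : ℝ) 1
        ∧ ((X (n + 1)).2 : ℝ) - (X n).2 ∈ Set.Icc (0 : ℝ) 1 := by
    refine ae_all_iff.2 fun n => ae_chainLaw_step _ _ (p := fun x y =>
      (y.1 : ℝ) - x.1 ∈ Set.Icc (0 : ℝ) 1 ∧ (y.2 : ℝ) - x.2 ∈ Set.Icc (0 : ℝ) 1) ?_ hinc n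
    exact (measurableSet_Icc.preimage (by fun_prop)).inter
      (measurableSet_Icc.preimage (by fun_prop))
  have hzero := ae_chainLaw_zero (urnKernel rowRed rowBlack) x₀
  -- For an empty urn `0 / 0 = 0` makes `redFraction` zero, so black would be drawn surely while the
  -- formula for the black fraction gives `0`.
  have hpos : ∀ᵐ X ∂chainLaw (urnKernel rowRed rowBlack) x₀, ∀ n, (X n).1 + (X n).2 ≠ 0 := by
    filter_upwards [hstep, hzero] with X hX h0 n
    have hmono : Monotone fun n => (X n).1 := monotone_nat_of_le_succ fun n => by
      exact_mod_cast sub_nonneg.1 (hX n).1.1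
    have : 0 < (X n).1 := (h0 ▸ hx₀).trans_le (hmono (Nat.zero_le n))
    positivity
  have hiR : Integrable (fun r : UrnContents => (r.1 : ℝ)) rowRed :=
    Integrable.of_bound (by fun_prop) 1 (by
      filter_upwards [hRed] with r hr
      simpa using hr.1)
  have hiB : Integrable (fun r : UrnContents => (r.2 : ℝ)) rowBlack :=
    Integrable.of_bound (by fun_prop) 1 (by
      filter_upwards [hBlack] with r hr
      simpa using hr.2)
  have hzR : (fun r : UrnContents => (r.2 : ℝ)) =ᵐ[rowRed] 0 := by
    filter_upwards [hRed] with r hr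
    simp [hr.2]
  have hzB : (fun r : UrnContents => (r.1 : ℝ)) =ᵐ[rowBlack] 0 := by
    filter_upwards [hBlack] with r hr
    simp [hr.1]
  refine ⟨fun n => ?_, fun n => ?_, ?_, ?_, ?_, ?_, fun n => ?_, fun n => ?_⟩
  · rw [Filtration.piLE_eq_comap_frestrictLe]
    exact ((by fun_prop : Measurable fun z : Finset.Iic n → UrnContents =>
      ((z ⟨n, Finset.mem_Iic.2 le_rfl⟩).1 : ℝ)).comp
        (comap_measurable (Preorder.frestrictLe (π := fun _ => UrnContents) n))).stronglyMeasurable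
  · rw [Filtration.piLE_eq_comap_frestrictLe]
    exact ((by fun_prop : Measurable fun z : Finset.Iic n → UrnContents =>
      ((z ⟨n, Finset.mem_Iic.2 le_rfl⟩).2 : ℝ)).comp
        (comap_measurable (Preorder.frestrictLe (π := fun _ => UrnContents) n))).stronglyMeasurable
  · filter_upwards [hzero] with X hX
    rw [hX]
  · filter_upwards [hzero] with X hX
    rw [hX]
  · filter_upwards [hstep] with X hX n using (hX n).1
  · filter_upwards [hstep] with X hX n using (hX n).2
  · have hi := condExp_chainLaw_step (urnKernel rowRed rowBlack) x₀
      (g := fun x y => (y.1 : ℝ) - x.1) (by fun_prop) n (Integrable.of_bound (by fun_prop) 1 (by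
        filter_upwards [hstep] with X hX
        rw [Real.norm_of_nonneg (hX n).1.1]
        exact (hX n).1.2))
    filter_upwards [hi, hpos] with X hX hp
    refine hX.trans ?_
    rw [integral_urnKernel _ (by fun_prop) (by simpa using hiR)
      (by simpa using (integrable_congr hzB).2 (integrable_zero _ _ _))]
    simp [ha, integral_congr_ae hzB, coe_redFraction, mul_comm]
  · have hi := condExp_chainLaw_step (urnKernel rowRed rowBlack) x₀
      (g := fun x y => (y.2 : ℝ) - x.2) (by fun_prop) n (Integrable.of_bound (by fun_prop) 1 (by
        filter_upwards [hstep] with X hX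
        rw [Real.norm_of_nonneg (hX n).2.1]
        exact (hX n).2.2))
    filter_upwards [hi, hpos] with X hX hp
    refine hX.trans ?_
    rw [integral_urnKernel _ (by fun_prop)
      (by simpa using (integrable_congr hzR).2 (integrable_zero _ _ _)) (by simpa using hiB),
      one_sub_redFraction (hp n)]
    simp [hb, integral_congr_ae hzR, mul_comm]

theorem ae_tendsto_redFraction {a b : ℝ} (ha0 : 0 ≤ a) (hb0 : 0 ≤ b)
    (hRed : ∀ᵐ r ∂rowRed, r.1 ≤ 1 ∧ r.2 = 0)
    (hBlack : ∀ᵐ r ∂rowBlack, r.1 = 0 ∧ r.2 ≤ 1) (ha : ∫ r, (r.1 : ℝ) ∂rowRed = a)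
    (hb : ∫ r, (r.2 : ℝ) ∂rowBlack = b) {x₀ : UrnContents} (h₁ : 0 < x₀.1) (h₂ : 0 < x₀.2) :
    (b < a → ∀ᵐ X ∂chainLaw (urnKernel rowRed rowBlack) x₀,
      Tendsto (fun n => redFraction (X n)) atTop (𝓝 1)) ∧
    (a < b → ∀ᵐ X ∂chainLaw (urnKernel rowRed rowBlack) x₀,
      Tendsto (fun n => redFraction (X n)) atTop (𝓝 0)) := by
  have h := isUrnProcess_chainLaw hRed hBlack ha hb h₁
  refine ⟨fun hab => ?_, fun hab => ?_⟩
  · filter_upwards [h.ae_tendsto_div_zero (by exact_mod_cast h₁) (by positivity) hb0 hab,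
      h.ae_bounds] with X hX hpos
    rw [← NNReal.tendsto_coe, NNReal.coe_one]
    -- The red fraction is `(1 + B / R)⁻¹`.
    have := (hX.const_add 1).inv₀ (by norm_num)
    rw [add_zero, inv_one] at this
    refine this.congr fun n => ?_
    have hp : (0 : ℝ) < (X n).1 := lt_of_lt_of_le (by exact_mod_cast h₁) (hpos n).1
    rw [coe_redFraction]
    field_simp
  · filter_upwards [h.symm.ae_tendsto_div_zero (by exact_mod_cast h₂) (by positivity) ha0 hab,
      h.symm.ae_bounds] with X hX hpos
    rw [← NNReal.tendsto_coe, NNReal.coe_zero]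
    have := hX.div (hX.add_const 1) (by norm_num)
    rw [zero_div] at this
    refine this.congr fun n => ?_
    have hp : (0 : ℝ) < (X n).2 := lt_of_lt_of_le (by exact_mod_cast h₂) (hpos n).1
    rw [coe_redFraction, Pi.div_apply]
    field_simp

end Rows

/-! ### One-step laws and the conditional identity. -/

theorem bernoulliUrn_apply (lamA lamB : I) (x : UrnContents) :
    bernoulliUrn lamA lamB x
      = (redFraction x * toNNReal lamA) • Measure.dirac (x + (1, 0))
        + (redFraction x * toNNReal (σ lamA)) • Measure.dirac x
        + (((1 - redFraction x) * toNNReal lamB) • Measure.dirac (x + (0, 1))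
          + ((1 - redFraction x) * toNNReal (σ lamB)) • Measure.dirac x) := by
  have hm : Measurable fun r : UrnContents => x + r := by fun_prop
  have h0 : x + ((0, 0) : UrnContents) = x := add_zero x
  rw [urnKernel_apply, bernoulliMeasure_def, bernoulliMeasure_def]
  simp only [Measure.map_add _ _ hm, Measure.map_smul, Measure.map_dirac, smul_add, smul_smul, h0]

theorem diagUrn_apply (lamA lamB : I) (x : UrnContents) :
    diagUrn lamA lamB x = redFraction x • Measure.dirac (x + (toNNReal lamA, 0))
      + (1 - redFraction x) • Measure.dirac (x + (0, toNNReal lamB)) := by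
  have hm : Measurable fun r : UrnContents => x + r := by fun_prop
  rw [urnKernel_apply]
  simp only [Measure.map_dirac]

theorem nnreal_one_sub_redFraction {x : UrnContents} (hx : x.1 + x.2 ≠ 0) :
    1 - redFraction x = x.2 / (x.1 + x.2) := by
  rw [← NNReal.coe_inj, NNReal.coe_sub (redFraction_le_one x), NNReal.coe_one,
    one_sub_redFraction hx]
  simp

theorem measurable_rescale (lamA lamB : I) : Measurable (rescale lamA lamB) := by
  unfold rescale; fun_prop

theorem restrict_bernoulliUrn (lamA lamB : I) (x : UrnContents) :
    (bernoulliUrn lamA lamB x).restrict {y | y ≠ x}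
      = (redFraction x * toNNReal lamA) • Measure.dirac (x + (1, 0))
        + ((1 - redFraction x) * toNNReal lamB) • Measure.dirac (x + (0, 1)) := by
  have hs : MeasurableSet {y : UrnContents | y ≠ x} := (measurableSet_singleton x).compl
  have h1 : x + ((1, 0) : UrnContents) ≠ x := by simp [Prod.ext_iff]
  have h2 : x + ((0, 1) : UrnContents) ≠ x := by simp [Prod.ext_iff]
  classical
  rw [bernoulliUrn_apply]
  simp only [Measure.restrict_add, Measure.restrict_smul, restrict_dirac' hs,
    Set.mem_ofPred_eq, if_pos h1, if_pos h2, ne_eq, not_true_eq_false, if_false, smul_zero, add_zero]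

theorem map_rescale_cond_bernoulliUrn (lamA lamB : I) {x : UrnContents}
    (hx : 0 < toNNReal lamA * x.1 + toNNReal lamB * x.2) :
    ((bernoulliUrn lamA lamB x)[|{y | y ≠ x}]).map (rescale lamA lamB)
      = diagUrn lamA lamB (rescale lamA lamB x) := by
  have hx' : x.1 + x.2 ≠ 0 := by
    intro h
    obtain ⟨h1, h2⟩ := add_eq_zero.1 h
    simp [h1, h2] at hx
  have hm := measurable_rescale lamA lamB
  -- The probability that a ball is added; dividing by it cancels `x.1 + x.2` and leaves the
  -- rescaled fractions.
  have hS : redFraction x * toNNReal lamA + (1 - redFraction x) * toNNReal lamB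
      = (toNNReal lamA * x.1 + toNNReal lamB * x.2) / (x.1 + x.2) := by
    rw [nnreal_one_sub_redFraction hx', redFraction]
    field_simp
  have hmass : bernoulliUrn lamA lamB x {y | y ≠ x}
      = (((toNNReal lamA * x.1 + toNNReal lamB * x.2) / (x.1 + x.2) : ℝ≥0) : ℝ≥0∞) := by
    rw [← Measure.restrict_apply_univ, restrict_bernoulliUrn, ← hS]
    simp [ENNReal.smul_def]
  have hA : rescale lamA lamB (x + (1, 0)) = rescale lamA lamB x + (toNNReal lamA, 0) := by
    simp [rescale, mul_add]
  have hB : rescale lamA lamB (x + (0, 1)) = rescale lamA lamB x + (0, toNNReal lamB) := by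
    simp [rescale, mul_add]
  have hne : (toNNReal lamA * x.1 + toNNReal lamB * x.2) / (x.1 + x.2) ≠ 0 :=
    div_ne_zero hx.ne' hx'
  rw [ProbabilityTheory.cond, hmass, restrict_bernoulliUrn, ← ENNReal.coe_inv hne, Measure.map_smul,
    Measure.map_add _ _ hm, Measure.map_smul, Measure.map_smul, Measure.map_dirac,
    Measure.map_dirac, hA, hB, diagUrn_apply, nnreal_one_sub_redFraction hx',
    nnreal_one_sub_redFraction (x := rescale lamA lamB x) hx.ne', ← ENNReal.smul_def, smul_add, smul_smul, smul_smul]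
  congr 2
  · simp only [redFraction, rescale]
    field_simp
  · simp only [rescale]
    field_simp

theorem ae_bernoulliMeasure {x y : UrnContents} (p : I) {q : UrnContents → Prop}
    (hx : q x) (hy : q y) : ∀ᵐ r ∂bernoulliMeasure x y p, q r := by
  rw [bernoulliMeasure_def, ae_add_measure_iff]
  refine ⟨Measure.ae_smul_measure ?_ _, Measure.ae_smul_measure ?_ _⟩ <;>
    simpa [ae_dirac_eq]

theorem mainTheorem1 (lamA lamB : I) :
    -- conditioned on adding a ball, the Bernoulli urn moves as the urn with matrix
    -- `diag(lamA, lamB)` whose contents are measured in units of `lamA` and `lamB`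
    (∀ x : UrnContents, 0 < toNNReal lamA * x.1 + toNNReal lamB * x.2 →
      ((bernoulliUrn lamA lamB x)[|{y | y ≠ x}]).map (rescale lamA lamB)
        = diagUrn lamA lamB (rescale lamA lamB x)) ∧
    -- in both urns, the probability of sampling red tends almost surely to `1` or `0`
    (∀ x₀ : UrnContents, 0 < x₀.1 → 0 < x₀.2 →
      (lamB < lamA →
        (∀ᵐ X ∂(chainLaw (bernoulliUrn lamA lamB) x₀),
          Tendsto (fun n => redFraction (X n)) atTop (𝓝 1)) ∧
        (∀ᵐ X ∂(chainLaw (diagUrn lamA lamB) x₀),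
          Tendsto (fun n => redFraction (X n)) atTop (𝓝 1))) ∧
      (lamA < lamB →
        (∀ᵐ X ∂(chainLaw (bernoulliUrn lamA lamB) x₀),
          Tendsto (fun n => redFraction (X n)) atTop (𝓝 0)) ∧
        (∀ᵐ X ∂(chainLaw (diagUrn lamA lamB) x₀),
          Tendsto (fun n => redFraction (X n)) atTop (𝓝 0)))) := by
  refine ⟨fun x hx => map_rescale_cond_bernoulliUrn lamA lamB hx, fun x₀ h₁ h₂ => ?_⟩
  have hBer := ae_tendsto_redFraction (rowRed := bernoulliMeasure (1, 0) (0, 0) lamA)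
    (rowBlack := bernoulliMeasure (0, 1) (0, 0) lamB) lamA.2.1 lamB.2.1
    (ae_bernoulliMeasure _ (by simp) (by simp)) (ae_bernoulliMeasure _ (by simp) (by simp))
    (by simp [integral_bernoulliMeasure]) (by simp [integral_bernoulliMeasure]) h₁ h₂
  have hA : toNNReal lamA ≤ 1 := lamA.2.2
  have hB : toNNReal lamB ≤ 1 := lamB.2.2
  have hDet := ae_tendsto_redFraction (rowRed := Measure.dirac (toNNReal lamA, 0))
    (rowBlack := Measure.dirac (0, toNNReal lamB)) lamA.2.1 lamB.2.1
    (by simp [ae_dirac_eq, hA]) (by simp [ae_dirac_eq, hB])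
    (by simp) (by simp) h₁ h₂
  exact ⟨fun h => ⟨hBer.1 h, hDet.1 h⟩, fun h => ⟨hBer.2 h, hDet.2 h⟩⟩
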